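/- **Nets.** A net has places, transitions and a flow relation; ${}^\bullet t$ and $t^\bullet$ are the input and output places of a transition $t$. A marking is a set $M$ of places; $t$ is enabled in $M$ if ${}^\bullet t\subseteq M$ and $t^\bullet\cap M=\emptyset$, and its occurrence leads to $(M\setminus{}^\bullet t)\cup t^\bullet$. A transition $t$ is live for an initial marking if from each reachable marking a marking enabling $t$ is reachable. A net is safe for an initial marking if, in the token game with token counts (a transition needs a token on each input place, removes one token from each input place and adds one token to each output place), each place contains at most one token in each reachable marking. **Cycloids.** The Petri space has transitions $t_{\xi,\eta}$, forward places $s_{\xi,\eta}$ and backward places $s'_{\xi,\eta}$ ($\xi,\eta\in\mathbb Z$), with arcs $t_{\xi,\eta}\to s_{\xi,\eta}\to t_{\xi+1,\eta}$ and $t_{\xi,\eta}\to s'_{\xi,\eta}\to t_{\xi,\eta+1}$. For positive integers $\alpha,\beta,\gamma,\delta$ the cycloid $\mathcal C(\alpha,\beta,\gamma,\delta)$ is its quotient by $x_{\xi,\eta}\equiv x_{\xi+m\alpha+n\gamma,\ \eta-m\beta+n\delta}$ ($m,n\in\mathbb Z$) for transitions, forward places and backward places separately. Let $\beta\mid\delta$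 and $p=(\alpha\delta+\beta\gamma)/\beta$. For $0\le i<p$, $0\le j<\beta$ write $[t_i,a_j]$, $[s_i,a_j]$, $[s'_i,a_j]$ for the classes of $t_{i-j,-j}$, $s_{i-j,-j}$, $s'_{i-j,-j}$; the $[t_i,a_j]$ and $[s_i,a_j]$ with fixed $j$ form the process of $a_j$. The regular initial marking is $\{s_{-1,i}\mid 0\ge i>-\beta\}\cup\{s'_{i,-\beta}\mid 0\le i<\alpha\}$, and for $0\le k<p$ the $k$-regular marking is $$\{[s_{(p-1+k)\bmod p},a_0]\}\cup\{[s_{(i+k)\bmod p},a_{i+1}]\mid 0\le i<\beta-1\}\cup\{[s'_{(i+k)\bmod p},a_0]\mid p-\alpha\le i<p\}.$$ The total backward folding $\mathcal C_{bf}(\alpha,\beta,\gamma,\delta)$ identifies, for each $i$, the backward places $[s'_i,a_j]$ with $0\le j<\beta$ (so nothing is identified if $\beta=1$). Markings of the cycloid are mapped to their images; the initial marking is the image of the regular initial marking. Write $\mathcal C_{bf}(g,c)=\mathcal C_{bf}(g,c,c,c)$; here $p=g+c$. The stop-resilient cycloid $\mathcal C^{stop}_{bf}(g,c)$ is $\mathcal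 C_{bf}(g,c)$ together with transitions $[t_{stop},a_j]$, $0\le j<c$, each with the single input place $[s_{(j-1)\bmod (g+c)},a_j]$ and the class of $[s'_j,a_j]$ as its single output place. **Theorem.** Let $g\ge 1$, $0<s<c$, and let $K\subseteq\{0,\dots,c-1\}$ with $|K|=s$. A *$K$-stopped marking* is a marking that is reached from the initial marking of $\mathcal C_0=\mathcal C^{stop}_{bf}(g,c)$ by an occurrence sequence in which $[t_{stop},a_j]$ occurs exactly for the $j\in K$. (a) There are $K$-stopped markings. For each $K$-stopped marking $M$, the net $\mathcal C_0$ with initial marking $M$ is safe, and all transitions $[t_i,a_j]$ with $j\notin K$ and $0\le i<g+c$ are live for $M$, provided that no further stop transitions occur (that is, they are live in $\mathcal C_{bf}(g,c)$ with initial marking $M$). (b) Let $\mathcal R$ be the net obtained from $\mathcal C_0$ by deleting all $[t_i,a_j]$ and $[s_i,a_j]$ with $j\in K$ and all stop transitions. There is a net isomorphism $\varphi$ from $\mathcal R$ onto $\mathcal C_1=\mathcal C_{bf}(g+s,c-s)$ such that for each $K$-stopped marking $M$ there are $k\in\{0,\dots,g+c-1\}$ and markings $M_0'$, $M_1'$ with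 the following properties. If $j_0<\dots<j_{c-s-1}$ are the indices outside $K$, then $M_0'$ consists of the places $[s_{(l-1+k)\bmod (g+c)},a_{j_l}]$ for $0\le l<c-s$ and the classes of $[s'_{(i+k)\bmod (g+c)},a_0]$ for $c-s\le i<g+c$, that is, $M_0'$ is a regular marking for the remaining processes; $M_0'$ is reachable in $\mathcal C_0$ from $M$ without further stop transitions (in particular it is a follower marking of the initial marking of $\mathcal C_0$) and contains no deleted place; $M_1'$ is the image of the $k$-regular marking in $\mathcal C_1$ and is reachable from the initial marking of $\mathcal C_1$; and $\varphi(M_0')=M_1'$. -/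

import Mathlib

/-- A net: places, transitions and the two halves of the flow relation. -/
structure Net where
  Place : Type
  Trans : Type
  /-- arcs from places to transitions -/
  inp : Place → Trans → Prop
  /-- arcs from transitions to places -/
  out : Trans → Place → Prop

namespace Net

/-- Input places of a transition. -/
def pre (N : Net) (t : N.Trans) : Set N.Place := {x | N.inp x t}

/-- Output places of a transition. -/
def post (N : Net) (t : N.Trans) : Set N.Place := {x | N.out t x}

/-- A transition is enabled in a marking (a set of places) if all its input places are marked
and none of its output places is. -/
def Enabled (N : Net) (M : Set N.Place) (t : N.Trans) : Prop :=
  N.pre t ⊆ M ∧ N.post t ∩ M = ∅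

/-- The occurrence of `t` leads from the marking `M` to the marking `M'`. -/
def Fires (N : Net) (M : Set N.Place) (t : N.Trans) (M' : Set N.Place) : Prop :=
  N.Enabled M t ∧ M' = (M \ N.pre t) ∪ N.post t

/-- The sequence of occurrences `σ` leads from `M` to `M'`. -/
inductive FiringSeq (N : Net) : Set N.Place → List N.Trans → Set N.Place → Prop
  | nil (M : Set N.Place) : FiringSeq N M [] M
  | cons {M M' M'' : Set N.Place} {t : N.Trans} {σ : List N.Trans} :
      N.Fires M t M' → FiringSeq N M' σ M'' → FiringSeq N M (t :: σ) M''

def Reachable (N : Net) (M M' : Set N.Place) : Prop := ∃ σ, N.FiringSeq M σ M'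

/-- The transition `t` is live with respect to the initial marking `M₀`. -/
def Live (N : Net) (M₀ : Set N.Place) (t : N.Trans) : Prop :=
  ∀ M, N.Reachable M₀ M → ∃ M', N.Reachable M M' ∧ N.Enabled M' t

/-- The token game with token counts: `t` needs a token on each input place, removes one token
from each input place and adds one token to each output place. There is no bound on the
number of tokens on a place. -/
def TokenFires (N : Net) (m : N.Place → ℕ) (t : N.Trans) (m' : N.Place → ℕ) : Prop :=
  (∀ x ∈ N.pre t, 1 ≤ m x) ∧
    ∀ x, m' x + (N.pre t).indicator (fun _ => 1) x = m x + (N.post t).indicator (fun _ => 1) x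

/-- The net is safe for the initial marking `M₀`: starting with one token on each place of `M₀`
and none elsewhere, each place contains at most one token in each marking that is
reachable in the token game. -/
def Safe (N : Net) (M₀ : Set N.Place) : Prop :=
  ∀ m : N.Place → ℕ,
    Relation.ReflTransGen (fun m₁ m₂ => ∃ t, N.TokenFires m₁ t m₂)
      (M₀.indicator (fun _ => 1)) m → ∀ x, m x ≤ 1

/-- Quotient of a net by equivalence relations on places and on transitions. -/
def quotient (N : Net) (rP : Setoid N.Place) (rT : Setoid N.Trans) : Net where
  Place := Quotient rP
  Trans := Quotient rT
  inp := fun x t => ∃ x₁ t₁, Quotient.mk rP x₁ = x ∧ Quotient.mk rT t₁ = t ∧ N.inp x₁ t₁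
  out := fun t x => ∃ t₁ x₁, Quotient.mk rT t₁ = t ∧ Quotient.mk rP x₁ = x ∧ N.out t₁ x₁

/-- Folding of places: places are identified along (the equivalence relation generated by) `r`,
transitions are kept. -/
def foldPlaces (N : Net) (r : N.Place → N.Place → Prop) : Net where
  Place := Quot r
  Trans := N.Trans
  inp := fun x t => ∃ x₁, Quot.mk r x₁ = x ∧ N.inp x₁ t
  out := fun t x => ∃ x₁, Quot.mk r x₁ = x ∧ N.out t x₁

/-- Deletion of a set of places and a set of transitions (with all adjacent arcs). -/
def delete (N : Net) (P : Set N.Place) (T : Set N.Trans) : Net where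
  Place := {x : N.Place // x ∉ P}
  Trans := {t : N.Trans // t ∉ T}
  inp := fun x t => N.inp x.1 t.1
  out := fun t x => N.out t.1 x.1

/-- Net isomorphisms. -/
structure Iso (N N' : Net) where
  onPlaces : N.Place ≃ N'.Place
  onTrans : N.Trans ≃ N'.Trans
  inp_iff : ∀ x t, N.inp x t ↔ N'.inp (onPlaces x) (onTrans t)
  out_iff : ∀ t x, N.out t x ↔ N'.out (onTrans t) (onPlaces x)

end Net

/-- Places of the Petri space: a forward place and a backward place for each point. -/
inductive PetriPlace
  | fwd (u : ℤ × ℤ)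
  | bwd (u : ℤ × ℤ)

/-- The Petri space; its transitions are the points of `ℤ × ℤ`. A place is named by its input
transition. -/
def petriSpace : Net where
  Place := PetriPlace
  Trans := ℤ × ℤ
  inp := fun x t => match x with
    | .fwd u => t = (u.1 + 1, u.2)
    | .bwd u => t = (u.1, u.2 + 1)
  out := fun t x => x = .fwd t ∨ x = .bwd t

/-- Equivalence of points of the Petri space with respect to cycloid parameters. -/
def pointRel (α β γ δ : ℕ) (u v : ℤ × ℤ) : Prop :=
  ∃ m n : ℤ, v = (u.1 + m * α + n * γ, u.2 - m * β + n * δ)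

theorem pointRel_equivalence (α β γ δ : ℕ) : Equivalence (pointRel α β γ δ) where
  refl := fun u => ⟨0, 0, by simp⟩
  symm := by
    rintro u v ⟨m, n, rfl⟩
    refine ⟨-m, -n, Prod.ext ?_ ?_⟩ <;> simp only [] <;> ring
  trans := by
    rintro u v w ⟨m, n, rfl⟩ ⟨m₁, n₁, rfl⟩
    refine ⟨m + m₁, n + n₁, Prod.ext ?_ ?_⟩ <;> simp only [] <;> ring

def pointSetoid (α β γ δ : ℕ) : Setoid (ℤ × ℤ) where
  r := pointRel α β γ δ
  iseqv := pointRel_equivalence α β γ δ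

/-- Equivalence of places: forward places and backward places are not mixed. -/
def placeRel (α β γ δ : ℕ) : PetriPlace → PetriPlace → Prop
  | .fwd u, .fwd v => pointRel α β γ δ u v
  | .bwd u, .bwd v => pointRel α β γ δ u v
  | _, _ => False

def placeSetoid (α β γ δ : ℕ) : Setoid PetriPlace where
  r := placeRel α β γ δ
  iseqv :=
    { refl := by
        rintro (u | u)
        · exact (pointRel_equivalence α β γ δ).refl u
        · exact (pointRel_equivalence α β γ δ).refl u
      symm := by
        rintro (u | u) (v | v) h
        · exact (pointRel_equivalence α β γ δ).symm h
        · exact h.elim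
        · exact h.elim
        · exact (pointRel_equivalence α β γ δ).symm h
      trans := by
        rintro (u | u) (v | v) (w | w) h₁ h₂
        · exact (pointRel_equivalence α β γ δ).trans h₁ h₂
        · exact h₂.elim
        · exact h₁.elim
        · exact h₁.elim
        · exact h₁.elim
        · exact h₁.elim
        · exact h₂.elim
        · exact (pointRel_equivalence α β γ δ).trans h₁ h₂ }

/-- The cycloid with the given parameters. -/
def cycloid (α β γ δ : ℕ) : Net :=
  petriSpace.quotient (placeSetoid α β γ δ) (pointSetoid α β γ δ)

/-- The process length (area divided by `β`) of a regular cycloid, i.e. one with `β ∣ δ`. -/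
def processLength (α β γ δ : ℕ) : ℕ := (α * δ + β * γ) / β

/-- The transition `[t_i, a_j]` in regular coordinates: `[t_0, a_j]` is the class of the point
`(-j, -j)`, and a step along the process of `a_j` increases the first coordinate by one. -/
def regTrans (α β γ δ : ℕ) (i j : ℤ) : (cycloid α β γ δ).Trans :=
  Quotient.mk (pointSetoid α β γ δ) (i - j, -j)

/-- The forward output place `[s_i, a_j]` of `[t_i, a_j]`. -/
def regFwd (α β γ δ : ℕ) (i j : ℤ) : (cycloid α β γ δ).Place :=
  Quotient.mk (placeSetoid α β γ δ) (.fwd (i - j, -j))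

/-- The backward output place `[s'_i, a_j]` of `[t_i, a_j]`. -/
def regBwd (α β γ δ : ℕ) (i j : ℤ) : (cycloid α β γ δ).Place :=
  Quotient.mk (placeSetoid α β γ δ) (.bwd (i - j, -j))

/-- The regular initial marking of a cycloid. -/
def regularMarking (α β γ δ : ℕ) : Set (cycloid α β γ δ).Place :=
  {x | ∃ i : ℤ, 0 ≥ i ∧ i > -(β : ℤ) ∧ x = Quotient.mk (placeSetoid α β γ δ) (.fwd (-1, i))} ∪
  {x | ∃ i : ℤ, 0 ≤ i ∧ i < (α : ℤ) ∧ x = Quotient.mk (placeSetoid α β γ δ) (.bwd (i, -(β : ℤ)))}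

/-- The `k`-regular marking of a regular cycloid. -/
def kRegularMarking (α β γ δ k : ℕ) : Set (cycloid α β γ δ).Place :=
  let p : ℤ := processLength α β γ δ
  {regFwd α β γ δ ((p - 1 + k) % p) 0} ∪
  {x | ∃ i : ℤ, 0 ≤ i ∧ i < (β : ℤ) - 1 ∧ x = regFwd α β γ δ ((i + k) % p) (i + 1)} ∪
  {x | ∃ i : ℤ, p - α ≤ i ∧ i < p ∧ x = regBwd α β γ δ ((i + k) % p) 0}

/-- Identification of backward places with the same position whose processes have their indices
in the set `D` of back indices. -/
def bfRel (α β γ δ : ℕ) (D : Set ℕ) (x y : (cycloid α β γ δ).Place) : Prop :=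
  ∃ i : ℕ, i < processLength α β γ δ ∧
    ∃ j ∈ D, ∃ l ∈ D, x = regBwd α β γ δ i j ∧ y = regBwd α β γ δ i l

/-- The relation of the total backward folding. -/
def totalBfRel (α β γ δ : ℕ) : (cycloid α β γ δ).Place → (cycloid α β γ δ).Place → Prop :=
  bfRel α β γ δ {j | j < β}

/-- The total backward folding of a regular cycloid. For `β = 1` nothing is identified. -/
def bfNet (α β γ δ : ℕ) : Net := (cycloid α β γ δ).foldPlaces (totalBfRel α β γ δ)

/-- The class of a place of the cycloid in its total backward folding. -/
def bfClass (α β γ δ : ℕ) (x : (cycloid α β γ δ).Place) : (bfNet α β γ δ).Place :=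
  Quot.mk (totalBfRel α β γ δ) x

/-- The net of the stop resilient cycloid with parameters `g` and `c`: the total backward folding
of the cycloid with parameters `g, c, c, c` together with the stop transitions `Sum.inr j`. -/
abbrev stopNet (g c : ℕ) : Net where
  Place := (bfNet g c c c).Place
  Trans := (bfNet g c c c).Trans ⊕ Fin c
  inp := fun x t => match t with
    | .inl t => (bfNet g c c c).inp x t
    | .inr j => x = bfClass g c c c (regFwd g c c c (((j : ℤ) - 1) % ((g : ℤ) + c)) j)
  out := fun t x => match t with
    | .inl t => (bfNet g c c c).out t x
    | .inr j => x = bfClass g c c c (regBwd g c c c j j)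

/-- The initial marking of a total backward folding: the image of the regular initial marking. -/
def bfInit (α β γ δ : ℕ) : Set (bfNet α β γ δ).Place :=
  bfClass α β γ δ '' regularMarking α β γ δ

/-- `M` is a result of stopping exactly the processes in `K`: it is reached from the initial
marking of the stop resilient cycloid by some sequence in which the stop transitions
that occur are those of the processes in `K`. -/
def StopResult (g c : ℕ) (K : Finset (Fin c)) (M : Set (bfNet g c c c).Place) : Prop :=
  ∃ σ : List (stopNet g c).Trans, (stopNet g c).FiringSeq (bfInit g c c c) σ M ∧
    ∀ j : Fin c, Sum.inr j ∈ σ ↔ j ∈ K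

/-- The forward places of the processes in `K`. -/
def stoppedPlaces (g c : ℕ) (K : Finset (Fin c)) : Set (stopNet g c).Place :=
  {x | ∃ j ∈ K, ∃ i : ℕ, i < g + c ∧ x = bfClass g c c c (regFwd g c c c i (j : ℕ))}

/-- The transitions of the processes in `K` and all stop transitions. -/
def stoppedTrans (g c : ℕ) (K : Finset (Fin c)) : Set (stopNet g c).Trans :=
  {t | ∃ j ∈ K, ∃ i : ℕ, i < g + c ∧ t = Sum.inl (regTrans g c c c i (j : ℕ))} ∪
  Set.range Sum.inr

/-- What remains of the stop resilient cycloid when the processes in `K` and all stop transitions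
are deleted. -/
def remainingNet (g c : ℕ) (K : Finset (Fin c)) : Net :=
  (stopNet g c).delete (stoppedPlaces g c K) (stoppedTrans g c K)

/-- The number of processes outside `K` with an index less than `j`. -/
def remainingIndex {c : ℕ} (K : Finset (Fin c)) (j : Fin c) : ℕ :=
  (Finset.univ.filter fun l : Fin c => l ∉ K ∧ l < j).card

/-- The `k`-regular marking of the stop resilient cycloid after the processes in `K` have been
stopped: the remaining processes, in the order of their indices, take the place that the
processes with consecutive indices from `0` on have in a `k`-regular marking, and the `g + #K`
remaining positions are free. -/
def stoppedRegularMarking (g c : ℕ) (K : Finset (Fin c)) (k : ℕ) :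
    Set (bfNet g c c c).Place :=
  {x | ∃ j : Fin c, j ∉ K ∧ x = bfClass g c c c
    (regFwd g c c c (((remainingIndex K j : ℤ) - 1 + k) % ((g : ℤ) + c)) (j : ℕ))} ∪
  {x | ∃ i : ℤ, (c : ℤ) - K.card ≤ i ∧ i < (g : ℤ) + c ∧
    x = bfClass g c c c (regBwd g c c c ((i + k) % ((g : ℤ) + c)) 0)}

/-! ### Coordinates on the folded cycloid -/

namespace Net

/-! The folded cycloid is traffic on a ring with `p = g + c` slots. A token on `fPlace (i - 1) j`
says that process `j` occupies slot `i`, a token on `bPlace i` says that slot `i` is free. The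
transition `[t_i, a_j]` moves `j` from slot `i` to a free slot `i + 1`; the stop transition of `j`
removes `j` from slot `j` and frees it (`bfNet_inp_iff`, `bfNet_out_iff`, `pre_stop`, `post_stop`).

Reachable markings are therefore `slotMarking A q`, where `A` is the set of present processes and
`q` lifts their slots to integers so that overtaking is excluded by `CyclicOrdered`. Moves preserve
the order and stops only shrink `A`, so `K`-stopped markings have `A = Kᶜ`.

The motor is `reachable_slotMarking`: every cyclically ordered configuration that lies nowhere
behind the present one can be reached, because `g > 0` leaves a free slot and so some unfinished
process can move (`CyclicOrdered.exists_unblocked`). Liveness, gathering into a regular marking and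
reachability of `k`-regular markings are choices of the target. Safety is a place invariant: each
slot holds one token in all, counting the free-space token.

Without `K` there are `c - s` processes on a ring of the same length `(g + s) + (c - s)`.
Renumbering them in increasing order gives the isomorphism. -/

/-- The forward place of process `j` at position `i` in the total backward folding. -/
def fPlace (g c : ℕ) (i j : ℤ) : (bfNet g c c c).Place := bfClass g c c c (regFwd g c c c i j)

/-- The backward place at position `i` in the total backward folding. -/
def bPlace (g c : ℕ) (i : ℤ) : (bfNet g c c c).Place := bfClass g c c c (regBwd g c c c i 0)

theorem intCast_zmod_eq_iff {p : ℕ} {a b : ℤ} : (a : ZMod p) = b ↔ ∃ m : ℤ, b = a + m * p := by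
  rw [ZMod.intCast_eq_intCast_iff_dvd_sub]
  constructor
  · rintro ⟨m, hm⟩
    exact ⟨m, by linarith⟩
  · rintro ⟨m, hm⟩
    exact ⟨m, by linarith⟩

/-- In the coordinates `(u.1 - u.2, -u.2)` the lattice of the cycloid is the product of the
multiples of `g + c` and of `c`: the coefficients `(m, n)` become `(m, m - n)`, a unimodular change.
-/
theorem pointRel_iff {g c : ℕ} (u v : ℤ × ℤ) :
    pointRel g c c c u v ↔
      ((u.1 - u.2 : ℤ) : ZMod (g + c)) = ((v.1 - v.2 : ℤ) : ZMod (g + c)) ∧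
        ((-u.2 : ℤ) : ZMod c) = ((-v.2 : ℤ) : ZMod c) := by
  rw [intCast_zmod_eq_iff, intCast_zmod_eq_iff]
  constructor
  · rintro ⟨m, n, rfl⟩
    refine ⟨⟨m, ?_⟩, ⟨m - n, ?_⟩⟩ <;> push_cast <;> ring
  · rintro ⟨⟨m, hm⟩, ⟨n, hn⟩⟩
    push_cast at hm
    refine ⟨m, m - n, Prod.ext ?_ ?_⟩ <;> simp only [] <;> linarith

theorem processLength_eq {g c : ℕ} (hc : 0 < c) : processLength g c c c = g + c := by
  rw [processLength, ← Nat.add_mul, Nat.mul_div_cancel _ hc]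

/-- The coordinates of a place of the Petri space in the total backward folding. -/
def petriCoord (g c : ℕ) : PetriPlace → (ZMod (g + c) × ZMod c) ⊕ ZMod (g + c)
  | .fwd u => .inl (((u.1 - u.2 : ℤ) : ZMod (g + c)), ((-u.2 : ℤ) : ZMod c))
  | .bwd u => .inr ((u.1 - u.2 : ℤ) : ZMod (g + c))

/-- The coordinates of a place of the cycloid in the total backward folding. -/
def cycloidCoord (g c : ℕ) : (cycloid g c c c).Place → (ZMod (g + c) × ZMod c) ⊕ ZMod (g + c) :=
  Quotient.lift (petriCoord g c) (by
    rintro (u | u) (v | v) h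
    · exact congrArg Sum.inl (Prod.ext ((pointRel_iff u v).1 h).1 ((pointRel_iff u v).1 h).2)
    · exact h.elim
    · exact h.elim
    · exact congrArg Sum.inr ((pointRel_iff u v).1 h).1)

/-- The coordinates of a place of the total backward folding. -/
def bfCoord (g c : ℕ) : (bfNet g c c c).Place → (ZMod (g + c) × ZMod c) ⊕ ZMod (g + c) :=
  Quot.lift (cycloidCoord g c) (by
    rintro _ _ ⟨i, -, j, -, l, -, rfl, rfl⟩
    change petriCoord g c (.bwd _) = petriCoord g c (.bwd _)
    simp [petriCoord])

@[simp] theorem bfCoord_fPlace (g c : ℕ) (i j : ℤ) :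
    bfCoord g c (fPlace g c i j) = .inl ((i : ZMod (g + c)), (j : ZMod c)) := by
  change petriCoord g c (.fwd _) = _
  simp [petriCoord]

@[simp] theorem bfCoord_bPlace (g c : ℕ) (i : ℤ) :
    bfCoord g c (bPlace g c i) = .inr (i : ZMod (g + c)) := by
  change petriCoord g c (.bwd _) = _
  simp [petriCoord]

theorem regFwd_eq {g c : ℕ} {i j i' j' : ℤ} (hi : (i : ZMod (g + c)) = i')
    (hj : (j : ZMod c) = j') : regFwd g c c c i j = regFwd g c c c i' j' :=
  Quotient.sound ((pointRel_iff _ _).2 (by simpa using ⟨hi, hj⟩))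

theorem regBwd_eq {g c : ℕ} {i j i' j' : ℤ} (hi : (i : ZMod (g + c)) = i')
    (hj : (j : ZMod c) = j') : regBwd g c c c i j = regBwd g c c c i' j' :=
  Quotient.sound ((pointRel_iff _ _).2 (by simpa using ⟨hi, hj⟩))

theorem regTrans_eq_iff {g c : ℕ} {i j i' j' : ℤ} :
    regTrans g c c c i j = regTrans g c c c i' j' ↔
      (i : ZMod (g + c)) = i' ∧ (j : ZMod c) = j' := by
  refine Quotient.eq.trans ((pointRel_iff _ _).trans ?_)
  simp

/-- The folding relation generates an equivalence that is awkward to invert, so places are separated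
by the invariant `bfCoord`. -/
theorem fPlace_eq_iff {g c : ℕ} {i j i' j' : ℤ} :
    fPlace g c i j = fPlace g c i' j' ↔ (i : ZMod (g + c)) = i' ∧ (j : ZMod c) = j' := by
  constructor
  · intro h
    have := congrArg (bfCoord g c) h
    simpa using this
  · rintro ⟨hi, hj⟩
    rw [fPlace, regFwd_eq hi hj, fPlace]

theorem bfClass_regBwd {g c : ℕ} (hc : 0 < c) (i j : ℤ) :
    bfClass g c c c (regBwd g c c c i j) = bPlace g c i := by
  have hp : (0 : ℤ) < ((g + c : ℕ) : ℤ) := by omega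
  have hc' : (0 : ℤ) < c := by omega
  -- The folding relation only mentions representatives in the standard ranges, so both indices are
  -- reduced first.
  have hi : (i : ZMod (g + c)) = (((i % ((g + c : ℕ) : ℤ)).toNat : ℤ) : ZMod (g + c)) := by
    rw [Int.toNat_of_nonneg (Int.emod_nonneg _ hp.ne'), ZMod.intCast_mod]
  have hj : (j : ZMod c) = (((j % (c : ℤ)).toNat : ℤ) : ZMod c) := by
    rw [Int.toNat_of_nonneg (Int.emod_nonneg _ hc'.ne'), ZMod.intCast_mod]
  rw [bPlace, regBwd_eq hi hj, regBwd_eq (j := 0) (j' := ((0 : ℕ) : ℤ)) hi (by simp)]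
  refine Quot.sound ⟨_, ?_, _, ?_, 0, hc, rfl, rfl⟩
  · rw [processLength_eq hc]
    have := Int.emod_lt_of_pos i hp
    have := Int.emod_nonneg i hp.ne'
    omega
  · have := Int.emod_lt_of_pos j hc'
    have := Int.emod_nonneg j hc'.ne'
    change (j % (c : ℤ)).toNat < c
    omega

theorem bPlace_eq_iff {g c : ℕ} {i i' : ℤ} :
    bPlace g c i = bPlace g c i' ↔ (i : ZMod (g + c)) = i' := by
  constructor
  · intro h
    have := congrArg (bfCoord g c) h
    simpa using this
  · intro hi
    rw [bPlace, regBwd_eq hi rfl, bPlace]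

@[simp] theorem fPlace_ne_bPlace {g c : ℕ} {i j i' : ℤ} : fPlace g c i j ≠ bPlace g c i' := by
  intro h
  have := congrArg (bfCoord g c) h
  simp at this

@[simp] theorem bPlace_ne_fPlace {g c : ℕ} {i j i' : ℤ} : bPlace g c i' ≠ fPlace g c i j :=
  fPlace_ne_bPlace.symm

theorem bfClass_mk_fwd {g c : ℕ} (u : ℤ × ℤ) :
    bfClass g c c c (Quotient.mk (placeSetoid g c c c) (.fwd u)) =
      fPlace g c (u.1 - u.2) (-u.2) := by
  simp [fPlace, regFwd]

theorem bfClass_mk_bwd {g c : ℕ} (hc : 0 < c) (u : ℤ × ℤ) :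
    bfClass g c c c (Quotient.mk (placeSetoid g c c c) (.bwd u)) = bPlace g c (u.1 - u.2) := by
  rw [← bfClass_regBwd hc _ (-u.2)]
  simp [regBwd]

theorem exists_fin_zmod_eq {c : ℕ} (hc : 0 < c) (j : ℤ) :
    ∃ l : Fin c, (j : ZMod c) = ((l : ℕ) : ℤ) := by
  have hc' : (0 : ℤ) < c := by omega
  have h1 := Int.emod_lt_of_pos j hc'
  have h2 := Int.emod_nonneg j hc'.ne'
  refine ⟨⟨(j % (c : ℤ)).toNat, by omega⟩, ?_⟩
  simp only [Int.toNat_of_nonneg h2]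
  rw [ZMod.intCast_mod]

theorem fin_zmod_inj {c : ℕ} {j l : Fin c} :
    (((j : ℕ) : ℤ) : ZMod c) = (((l : ℕ) : ℤ) : ZMod c) ↔ j = l := by
  rw [Int.cast_natCast, Int.cast_natCast, ZMod.natCast_eq_natCast_iff', Nat.mod_eq_of_lt j.2,
    Nat.mod_eq_of_lt l.2, Fin.ext_iff]

theorem place_cases {g c : ℕ} (hc : 0 < c) (x : (bfNet g c c c).Place) :
    (∃ (i : ℤ) (j : Fin c), x = fPlace g c i (j : ℕ)) ∨ ∃ i : ℤ, x = bPlace g c i := by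
  obtain ⟨x, rfl⟩ := Quot.exists_rep x
  obtain ⟨u | u, rfl⟩ := Quotient.exists_rep x
  · obtain ⟨l, hl⟩ := exists_fin_zmod_eq hc (-u.2)
    exact Or.inl ⟨_, l, (bfClass_mk_fwd u).trans (fPlace_eq_iff.2 ⟨rfl, hl⟩)⟩
  · exact Or.inr ⟨_, bfClass_mk_bwd hc u⟩

theorem trans_cases {g c : ℕ} (hc : 0 < c) (t : (bfNet g c c c).Trans) :
    ∃ (i : ℤ) (j : Fin c), t = regTrans g c c c i (j : ℕ) := by
  obtain ⟨u, rfl⟩ := Quotient.exists_rep t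
  obtain ⟨l, hl⟩ := exists_fin_zmod_eq hc (-u.2)
  refine ⟨u.1 - u.2, l, ?_⟩
  rw [← regTrans_eq_iff.2 ⟨rfl, hl⟩, regTrans, sub_neg_eq_add, sub_add_cancel, neg_neg]
  rfl

theorem bfNet_inp_iff {g c : ℕ} (hc : 0 < c) {x : (bfNet g c c c).Place} {i j : ℤ} :
    (bfNet g c c c).inp x (regTrans g c c c i j) ↔
      x = fPlace g c (i - 1) j ∨ x = bPlace g c (i + 1) := by
  constructor
  · rintro ⟨_, rfl, x, t, rfl, ht, h⟩
    obtain ⟨h1, h2⟩ := (pointRel_iff _ _).1 (Quotient.exact ht)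
    rcases x with u | u
    · obtain rfl : t = (u.1 + 1, u.2) := h
      refine Or.inl ((bfClass_mk_fwd u).trans (fPlace_eq_iff.2 ⟨?_, ?_⟩))
      · push_cast at h1 ⊢
        linear_combination h1
      · simpa using h2
    · obtain rfl : t = (u.1, u.2 + 1) := h
      refine Or.inr ((bfClass_mk_bwd hc u).trans (bPlace_eq_iff.2 ?_))
      push_cast at h1 ⊢
      linear_combination h1
  · rintro (rfl | rfl)
    · refine ⟨_, rfl, .fwd (i - 1 - j, -j), (i - j, -j), rfl, rfl, ?_⟩
      exact Prod.ext (by simp only []; ring) rfl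
    -- In the Petri space the backward input place comes from the neighbouring process `j + 1`;
    -- folding forgets this index.
    · rw [← bfClass_regBwd hc (i + 1) (j + 1)]
      refine ⟨_, rfl, .bwd (i + 1 - (j + 1), -(j + 1)), (i - j, -j), rfl, rfl, ?_⟩
      exact Prod.ext (by simp only []; ring) (by simp only []; ring)

theorem bfNet_out_iff {g c : ℕ} (hc : 0 < c) {x : (bfNet g c c c).Place} {i j : ℤ} :
    (bfNet g c c c).out (regTrans g c c c i j) x ↔ x = fPlace g c i j ∨ x = bPlace g c i := by
  constructor
  · rintro ⟨_, rfl, t, x, ht, rfl, h⟩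
    obtain ⟨h1, h2⟩ := (pointRel_iff _ _).1 (Quotient.exact ht)
    rcases h with rfl | rfl
    · refine Or.inl ((bfClass_mk_fwd t).trans (fPlace_eq_iff.2 ⟨?_, ?_⟩))
      · rw [h1]; simp
      · rw [h2]; simp
    · refine Or.inr ((bfClass_mk_bwd hc t).trans (bPlace_eq_iff.2 ?_))
      rw [h1]; simp
  · rintro (rfl | rfl)
    · exact ⟨_, rfl, (i - j, -j), .fwd (i - j, -j), rfl, rfl, Or.inl rfl⟩
    · rw [← bfClass_regBwd hc i j]
      exact ⟨_, rfl, (i - j, -j), .bwd (i - j, -j), rfl, rfl, Or.inr rfl⟩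

theorem pre_regTrans {g c : ℕ} (hc : 0 < c) (i j : ℤ) :
    (bfNet g c c c).pre (regTrans g c c c i j) = {fPlace g c (i - 1) j, bPlace g c (i + 1)} :=
  Set.ext fun _ => bfNet_inp_iff hc

theorem post_regTrans {g c : ℕ} (hc : 0 < c) (i j : ℤ) :
    (bfNet g c c c).post (regTrans g c c c i j) = {fPlace g c i j, bPlace g c i} :=
  Set.ext fun _ => bfNet_out_iff hc

theorem pre_stop {g c : ℕ} (j : Fin c) :
    (stopNet g c).pre (Sum.inr j) = {fPlace g c ((j : ℕ) - 1) (j : ℕ)} := by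
  refine Set.ext fun x => ?_
  rw [← fPlace_eq_iff (i := ((j : ℕ) - 1) % ((g : ℤ) + c)) (j := (j : ℕ)) |>.2 ⟨?_, rfl⟩]
  · rfl
  · exact_mod_cast ZMod.intCast_mod (((j : ℕ) : ℤ) - 1) (g + c)

theorem post_stop {g c : ℕ} (j : Fin c) :
    (stopNet g c).post (Sum.inr j) = {bPlace g c (j : ℕ)} := by
  refine Set.ext fun x => ?_
  rw [← bfClass_regBwd (by have := j.2; omega) (j : ℕ) (j : ℕ)]
  rfl

/-! ### Processes on a ring of slots -/

section

/-- The marking in which exactly the processes in `A` are present, the process `j` being in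
the slot `q j`, that is, with a token between the positions `q j - 1` and `q j`. -/
def slotMarking (g c : ℕ) (A : Finset (Fin c)) (q : Fin c → ℤ) : Set (bfNet g c c c).Place :=
  {x | ∃ j ∈ A, x = fPlace g c (q j - 1) (j : ℕ)} ∪
  {x | ∃ i : ℤ, (∀ j ∈ A, (q j : ZMod (g + c)) ≠ i) ∧ x = bPlace g c i}

/-- The slots of the processes in `A` are distinct and in cyclic order. -/
def CyclicOrdered (p : ℕ) {c : ℕ} (A : Finset (Fin c)) (q : Fin c → ℤ) : Prop :=
  ∀ i ∈ A, ∀ j ∈ A, i < j → q i < q j ∧ q j < q i + p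

variable {g c : ℕ} {A : Finset (Fin c)} {q : Fin c → ℤ}

theorem fPlace_mem_slotMarking {i : ℤ} {j : Fin c} :
    fPlace g c i (j : ℕ) ∈ slotMarking g c A q ↔ j ∈ A ∧ (q j : ZMod (g + c)) = i + 1 := by
  constructor
  · rintro (⟨l, hl, h⟩ | ⟨_, _, h⟩)
    · obtain ⟨h1, h2⟩ := fPlace_eq_iff.1 h
      obtain rfl := fin_zmod_inj.1 h2
      refine ⟨hl, ?_⟩
      rw [h1]; simp
    · exact absurd h fPlace_ne_bPlace
  · rintro ⟨hj, h⟩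
    refine Or.inl ⟨j, hj, fPlace_eq_iff.2 ⟨?_, rfl⟩⟩
    rw [Int.cast_sub, h]; simp

theorem bPlace_mem_slotMarking {i : ℤ} :
    bPlace g c i ∈ slotMarking g c A q ↔ ∀ j ∈ A, (q j : ZMod (g + c)) ≠ i := by
  constructor
  · rintro (⟨l, hl, h⟩ | ⟨k, hk, h⟩)
    · exact absurd h bPlace_ne_fPlace
    · rwa [bPlace_eq_iff.1 h]
  · exact fun h => Or.inr ⟨i, h, rfl⟩

theorem eq_slotMarking (hc : 0 < c) {S : Set (bfNet g c c c).Place}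
    (hf : ∀ (i : ℤ) (j : Fin c),
      fPlace g c i (j : ℕ) ∈ S ↔ j ∈ A ∧ (q j : ZMod (g + c)) = i + 1)
    (hb : ∀ i : ℤ, bPlace g c i ∈ S ↔ ∀ j ∈ A, (q j : ZMod (g + c)) ≠ i) :
    S = slotMarking g c A q := by
  ext x
  obtain ⟨i, j, rfl⟩ | ⟨i, rfl⟩ := place_cases hc x
  · rw [hf, fPlace_mem_slotMarking]
  · rw [hb, bPlace_mem_slotMarking]

/-- The marking sees only residues, so integer lifts may be shifted by whole turns to get ahead of a
given configuration. -/
theorem slotMarking_congr (hc : 0 < c) {q' : Fin c → ℤ}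
    (h : ∀ j ∈ A, (q j : ZMod (g + c)) = q' j) :
    slotMarking g c A q = slotMarking g c A q' := by
  refine eq_slotMarking hc (fun i j => ?_) fun i => ?_
  · rw [fPlace_mem_slotMarking]
    exact and_congr_right fun hj => by rw [h j hj]
  · rw [bPlace_mem_slotMarking]
    exact forall₂_congr fun j hj => by rw [h j hj]

theorem CyclicOrdered.zmod_inj {p : ℕ} (h : CyclicOrdered p A q) {i j : Fin c}
    (hi : i ∈ A) (hj : j ∈ A) (e : (q i : ZMod p) = q j) : i = j := by
  obtain ⟨m, hm⟩ := intCast_zmod_eq_iff.1 e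
  rcases lt_trichotomy i j with hlt | rfl | hlt
  · obtain ⟨h1, h2⟩ := h i hi j hj hlt
    have : 0 < m := by by_contra!; nlinarith
    have : m < 1 := by by_contra!; nlinarith
    omega
  · rfl
  · obtain ⟨h1, h2⟩ := h j hj i hi hlt
    have : m < 0 := by by_contra!; nlinarith
    have : -1 < m := by by_contra!; nlinarith
    omega

theorem CyclicOrdered.mono {p : ℕ} {B : Finset (Fin c)} (h : CyclicOrdered p A q) (hB : B ⊆ A) :
    CyclicOrdered p B q := fun i hi j hj => h i (hB hi) j (hB hj)

/-- A process may advance if the slot in front of it is free. -/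
theorem CyclicOrdered.advance {p : ℕ} (h : CyclicOrdered p A q) {j : Fin c} (hj : j ∈ A)
    (hfree : ∀ l ∈ A, (q l : ZMod p) ≠ q j + 1) :
    CyclicOrdered p A (Function.update q j (q j + 1)) := by
  intro a ha b hb hab
  obtain ⟨h1, h2⟩ := h a ha b hb hab
  by_cases haj : a = j
  · subst haj
    rw [Function.update_self, Function.update_of_ne hab.ne']
    refine ⟨lt_of_le_of_ne (by omega) fun e => hfree b hb ?_, by omega⟩
    rw [← e]; simp
  · rw [Function.update_of_ne haj]
    by_cases hbj : b = j
    · subst hbj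
      rw [Function.update_self]
      -- Equality would mean that `b` has caught up with `a` after a full turn, so that modulo `p`
      -- the process `a` sits in the slot required to be free.
      refine ⟨by omega, lt_of_le_of_ne (by omega) fun e => hfree a ha ?_⟩
      have := congrArg (Int.cast : ℤ → ZMod p) e
      push_cast at this
      simpa using this.symm
    · rw [Function.update_of_ne hbj]
      exact ⟨h1, h2⟩

theorem one_ne_zero_zmod (hg : 0 < g) (hc : 0 < c) : (1 : ZMod (g + c)) ≠ 0 := by
  have : Fact (1 < g + c) := ⟨by omega⟩
  exact one_ne_zero

/-- The process and the free-space token exchange slots. Cyclic order is needed only for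
distinctness of the slots, which makes the slot left behind really free; `g > 0` makes the two slots
different. -/
theorem fires_slotMarking (hg : 0 < g) (h : CyclicOrdered (g + c) A q) {j : Fin c} (hj : j ∈ A)
    (hfree : ∀ l ∈ A, (q l : ZMod (g + c)) ≠ q j + 1) :
    (bfNet g c c c).Fires (slotMarking g c A q) (regTrans g c c c (q j) (j : ℕ))
      (slotMarking g c A (Function.update q j (q j + 1))) := by
  have hc : 0 < c := by have := j.2; omega
  have h1 := one_ne_zero_zmod hg hc
  have hinj : ∀ l ∈ A, (q l : ZMod (g + c)) = q j → l = j := fun l hl e =>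
    h.zmod_inj hl hj e
  unfold Fires Enabled
  rw [pre_regTrans hc, post_regTrans hc]
  refine ⟨⟨?_, ?_⟩, Eq.symm (eq_slotMarking hc ?_ ?_)⟩
  · rintro _ (rfl | rfl)
    · rw [fPlace_mem_slotMarking]
      exact ⟨hj, by simp⟩
    · rw [bPlace_mem_slotMarking]
      simpa using hfree
  · ext x
    simp only [Set.mem_inter_iff, Set.mem_empty_iff_false, iff_false, not_and]
    rintro (rfl | rfl)
    · rw [fPlace_mem_slotMarking]
      rintro ⟨-, e⟩
      exact h1 (by linear_combination -e)
    · rw [bPlace_mem_slotMarking]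
      exact fun e => e j hj rfl
  · intro i l
    simp only [Set.mem_union, Set.mem_sdiff, Set.mem_insert_iff, Set.mem_singleton_iff,
      fPlace_mem_slotMarking, fPlace_eq_iff, fPlace_ne_bPlace, or_false, fin_zmod_inj]
    by_cases hl : l = j
    · subst hl
      rw [Function.update_self]
      push_cast
      constructor
      · rintro (⟨⟨-, e⟩, hn⟩ | ⟨e, -⟩)
        · exact absurd ⟨by linear_combination -e, rfl⟩ hn
        · exact ⟨hj, by rw [e]⟩
      · rintro ⟨-, e⟩
        exact Or.inr ⟨by linear_combination -e, rfl⟩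
    · rw [Function.update_of_ne hl]
      simp [hl]
  · intro i
    simp only [Set.mem_union, Set.mem_sdiff, Set.mem_insert_iff, Set.mem_singleton_iff,
      bPlace_mem_slotMarking, bPlace_eq_iff, bPlace_ne_fPlace, false_or]
    constructor
    · rintro (⟨e, hn⟩ | e) l hl
      · by_cases hlj : l = j
        · subst hlj
          rw [Function.update_self]
          exact fun e' => hn e'.symm
        · rw [Function.update_of_ne hlj]
          exact e l hl
      · by_cases hlj : l = j
        · subst hlj
          rw [Function.update_self, e]
          push_cast
          exact fun e' => h1 (by linear_combination e')
        · rw [Function.update_of_ne hlj, e]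
          exact fun e' => hlj (hinj l hl e')
    · intro e
      by_cases hi : (i : ZMod (g + c)) = q j
      · exact Or.inr hi
      · refine Or.inl ⟨fun l hl => ?_, fun e' => ?_⟩
        · by_cases hlj : l = j
          · subst hlj
            exact fun e' => hi e'.symm
          · have := e l hl
            rwa [Function.update_of_ne hlj] at this
        · have := e j hj
          rw [Function.update_self] at this
          exact this e'.symm

theorem fires_stop_slotMarking (h : CyclicOrdered (g + c) A q) {j : Fin c} (hj : j ∈ A)
    (hq : (q j : ZMod (g + c)) = ((j : ℕ) : ℤ)) :
    (stopNet g c).Fires (slotMarking g c A q) (Sum.inr j) (slotMarking g c (A.erase j) q) := by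
  have hc : 0 < c := by have := j.2; omega
  rw [Fires, Enabled, pre_stop, post_stop]
  refine ⟨⟨?_, ?_⟩, Eq.symm (eq_slotMarking hc ?_ ?_)⟩
  · rintro _ rfl
    rw [fPlace_mem_slotMarking]
    exact ⟨hj, by rw [hq]; simp⟩
  · ext x
    simp only [Set.mem_inter_iff, Set.mem_empty_iff_false, iff_false, not_and]
    rintro rfl
    rw [bPlace_mem_slotMarking]
    exact fun e => e j hj hq
  · intro i l
    simp only [Set.mem_union, Set.mem_sdiff, Set.mem_singleton_iff,
      fPlace_mem_slotMarking, fPlace_eq_iff, fPlace_ne_bPlace, or_false, fin_zmod_inj,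
      Finset.mem_erase]
    constructor
    · rintro ⟨⟨hl, e⟩, hn⟩
      refine ⟨⟨?_, hl⟩, e⟩
      rintro rfl
      refine hn ⟨?_, rfl⟩
      rw [hq] at e
      push_cast at e ⊢
      linear_combination -e
    · rintro ⟨⟨hl, hl'⟩, e⟩
      exact ⟨⟨hl', e⟩, fun e' => hl e'.2⟩
  · intro i
    simp only [Set.mem_union, Set.mem_sdiff, Set.mem_singleton_iff,
      bPlace_mem_slotMarking, bPlace_eq_iff, bPlace_ne_fPlace,
      Finset.mem_erase]
    constructor
    · rintro (⟨e, -⟩ | e) l ⟨hl, hl'⟩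
      · exact e l hl'
      · rw [e, ← hq]
        exact fun e' => hl (h.zmod_inj hl' hj e')
    · intro e
      by_cases hi : (i : ZMod (g + c)) = ((j : ℕ) : ℤ)
      · exact Or.inr hi
      · refine Or.inl ⟨fun l hl => ?_, not_false⟩
        by_cases hlj : l = j
        · subst hlj
          rw [hq]
          exact fun e' => hi e'.symm
        · exact e l ⟨hlj, hl⟩

/-- From a marking of processes in cyclic order only processes with a free slot in front of them
can move, and cyclic order is kept. -/
theorem Fires.exists_slotMarking (hg : 0 < g) (h : CyclicOrdered (g + c) A q)
    {t : (bfNet g c c c).Trans} {M : Set (bfNet g c c c).Place} (hc : 0 < c)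
    (ht : (bfNet g c c c).Fires (slotMarking g c A q) t M) :
    ∃ q', CyclicOrdered (g + c) A q' ∧ M = slotMarking g c A q' := by
  obtain ⟨i, j, rfl⟩ := trans_cases hc t
  have hpre := ht.1.1
  rw [pre_regTrans hc, Set.insert_subset_iff, Set.singleton_subset_iff, fPlace_mem_slotMarking,
    bPlace_mem_slotMarking] at hpre
  obtain ⟨⟨hj, e⟩, hfree⟩ := hpre
  have e' : (q j : ZMod (g + c)) = i := by rw [e]; simp
  have hfree' : ∀ l ∈ A, (q l : ZMod (g + c)) ≠ q j + 1 := by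
    intro l hl
    rw [e']
    simpa using hfree l hl
  refine ⟨_, h.advance hj hfree', ?_⟩
  rw [ht.2, (fires_slotMarking hg h hj hfree').2, regTrans_eq_iff.2 ⟨e', rfl⟩]

theorem FiringSeq.exists_slotMarking (hg : 0 < g) (hc : 0 < c) (h : CyclicOrdered (g + c) A q)
    {σ : List (bfNet g c c c).Trans} {M : Set (bfNet g c c c).Place}
    (hσ : (bfNet g c c c).FiringSeq (slotMarking g c A q) σ M) :
    ∃ q', CyclicOrdered (g + c) A q' ∧ M = slotMarking g c A q' := by
  generalize hM₀ : slotMarking g c A q = M₀ at hσ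
  induction hσ generalizing q with
  | nil => exact ⟨q, h, hM₀.symm⟩
  | cons hf _ ih =>
    subst hM₀
    obtain ⟨q', h', rfl⟩ := hf.exists_slotMarking hg h hc
    exact ih h' rfl

/-- Each stop erases its process from `A`, and a subfamily stays cyclically ordered; hence the
surviving set can be read off from the sequence alone. -/
theorem FiringSeq.exists_slotMarking_stop (hg : 0 < g) (hc : 0 < c)
    (h : CyclicOrdered (g + c) A q)
    {σ : List (stopNet g c).Trans} {M : Set (stopNet g c).Place}
    (hσ : (stopNet g c).FiringSeq (slotMarking g c A q) σ M) :
    ∃ A' q', CyclicOrdered (g + c) A' q' ∧ M = slotMarking g c A' q' ∧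
      ∀ j, j ∈ A' ↔ j ∈ A ∧ Sum.inr j ∉ σ := by
  refine FiringSeq.rec (N := stopNet g c)
    (motive := fun M₀ σ M _ => ∀ A q, CyclicOrdered (g + c) A q → M₀ = slotMarking g c A q →
      ∃ A' q', CyclicOrdered (g + c) A' q' ∧ M = slotMarking g c A' q' ∧
        ∀ j, j ∈ A' ↔ j ∈ A ∧ Sum.inr j ∉ σ)
    (fun M A q h e => ⟨A, q, h, e, by simp⟩) ?_ hσ A q h rfl
  rintro _ M' _ (t | j) _ hf _ ih A q h rfl
  · obtain ⟨q', h', rfl⟩ :=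
      Fires.exists_slotMarking (t := t) hg h hc (show (bfNet g c c c).Fires _ t _ from hf)
    obtain ⟨A'', q'', h1, h2, h3⟩ := ih A q' h' rfl
    exact ⟨A'', q'', h1, h2, fun l => by rw [h3]; simp⟩
  · have hpre := hf.1.1
    rw [pre_stop, Set.singleton_subset_iff, fPlace_mem_slotMarking] at hpre
    obtain ⟨hj, e⟩ := hpre
    have e' : (q j : ZMod (g + c)) = ((j : ℕ) : ℤ) := by rw [e]; simp
    have hM' : M' = slotMarking g c (A.erase j) q := by
      rw [hf.2, (fires_stop_slotMarking h hj e').2]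
    obtain ⟨A'', q'', h1, h2, h3⟩ := ih _ q (h.mono (A.erase_subset j)) hM'
    refine ⟨A'', q'', h1, h2, fun l => ?_⟩
    rw [h3, Finset.mem_erase]
    simp only [List.mem_cons, Sum.inr.injEq, not_or]
    tauto

theorem FiringSeq.map_inl {M M' : Set (bfNet g c c c).Place} {σ : List (bfNet g c c c).Trans}
    (h : (bfNet g c c c).FiringSeq M σ M') :
    (stopNet g c).FiringSeq M (σ.map Sum.inl) M' := by
  induction h with
  | nil => exact .nil _
  | cons hf _ ih => exact .cons (t := Sum.inl _) hf ih

theorem FiringSeq.append {N : Net} {M M' M'' : Set N.Place} {σ τ : List N.Trans}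
    (h : N.FiringSeq M σ M') (h' : N.FiringSeq M' τ M'') : N.FiringSeq M (σ ++ τ) M'' := by
  induction h with
  | nil => exact h'
  | cons hf _ ih => exact .cons hf (ih h')

end

/-! ### Progress and liveness -/

section

variable {g c : ℕ} {A : Finset (Fin c)} {q T : Fin c → ℤ}

/-- If some process has not reached its target, then some such process is not blocked: the process
that blocks it has not reached its target either, and there is a free slot. -/
theorem CyclicOrdered.exists_unblocked (hg : 0 < g) (h : CyclicOrdered (g + c) A q)
    (hT : CyclicOrdered (g + c) A T) {j : Fin c} (hj : j ∈ A) (hlt : q j < T j) :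
    ∃ l ∈ A, q l < T l ∧ ∀ l' ∈ A, (q l' : ZMod (g + c)) ≠ q l + 1 := by
  by_contra! hcon
  -- Following blockers forward from `j` would fill every slot of the ring with unfinished
  -- processes.
  have key : ∀ e : ℕ, ∃ l ∈ A, q l < T l ∧ (q l : ZMod (g + c)) = q j + e := by
    intro e
    induction e with
    | zero => exact ⟨j, hj, hlt, by simp⟩
    | succ e ih =>
      obtain ⟨l, hl, hlT, hle⟩ := ih
      obtain ⟨l', hl', hll'⟩ := hcon l hl hlT
      refine ⟨l', hl', ?_, by rw [hll', hle]; push_cast; ring⟩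
      obtain ⟨m, hm⟩ := intCast_zmod_eq_iff.1
        (show ((q l' : ℤ) : ZMod (g + c)) = ((q l + 1 : ℤ) : ZMod (g + c)) by simpa using hll')
      have hp : (2 : ℤ) ≤ ((g + c : ℕ) : ℤ) := by have := j.2; omega
      -- A blocker of higher index is directly ahead (`m = 0`), one of lower index is ahead after a
      -- full turn (`m = 1`). In both cases the order of the targets keeps it short of its own. A
      -- process cannot block itself, as there are at least two slots.
      rcases lt_trichotomy l l' with hlt' | rfl | hlt'
      · obtain ⟨h1, h2⟩ := h l hl l' hl' hlt'
        obtain ⟨h3, h4⟩ := hT l hl l' hl' hlt'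
        generalize ((g + c : ℕ) : ℤ) = p at hm hp h2 h4
        have : m < 1 := by by_contra!; nlinarith
        have : -1 < m := by by_contra!; nlinarith
        obtain rfl : m = 0 := by omega
        omega
      · have : m < 1 := by by_contra!; nlinarith
        have : 0 < m := by by_contra!; nlinarith
        omega
      · obtain ⟨h1, h2⟩ := h l' hl' l hl hlt'
        obtain ⟨h3, h4⟩ := hT l' hl' l hl hlt'
        generalize ((g + c : ℕ) : ℤ) = p at hm hp h2 h4
        have : m < 2 := by by_contra!; nlinarith
        have : 0 < m := by by_contra!; nlinarith
        obtain rfl : m = 1 := by omega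
        omega
  have : NeZero (g + c) := ⟨by omega⟩
  -- But `c` processes cannot occupy `g + c > c` slots.
  have hsurj : Function.Surjective fun l : Fin c => (q l : ZMod (g + c)) := by
    intro x
    obtain ⟨l, -, -, hl⟩ := key (x - q j).val
    exact ⟨l, by simp only [hl, ZMod.natCast_zmod_val]; ring⟩
  have := Fintype.card_le_of_surjective _ hsurj
  rw [ZMod.card, Fintype.card_fin] at this
  omega

/-- Moving any unblocked unfinished process by one slot lowers the total remaining distance and
overshoots no target. -/
theorem reachable_slotMarking (hg : 0 < g) (hc : 0 < c) (h : CyclicOrdered (g + c) A q)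
    (hT : CyclicOrdered (g + c) A T) (hle : ∀ j ∈ A, q j ≤ T j) :
    (bfNet g c c c).Reachable (slotMarking g c A q) (slotMarking g c A T) := by
  induction hn : ∑ j ∈ A, (T j - q j).toNat using Nat.strong_induction_on generalizing q with
  | _ n ih =>
    by_cases hall : ∀ j ∈ A, q j = T j
    · rw [slotMarking_congr hc fun j hj => by rw [hall j hj]]
      exact ⟨[], .nil _⟩
    · push Not at hall
      obtain ⟨j₀, hj₀, hne⟩ := hall
      obtain ⟨j, hj, hlt, hfree⟩ :=
        h.exists_unblocked hg hT hj₀ (lt_of_le_of_ne (hle j₀ hj₀) hne)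
      have hle' : ∀ l ∈ A, Function.update q j (q j + 1) l ≤ T l := by
        intro l hl
        by_cases hlj : l = j
        · subst hlj
          rw [Function.update_self]
          omega
        · rw [Function.update_of_ne hlj]
          exact hle l hl
      obtain ⟨σ, hσ⟩ := ih _ (by
        rw [← hn]
        refine Finset.sum_lt_sum (fun l hl => ?_) ⟨j, hj, ?_⟩
        · by_cases hlj : l = j
          · subst hlj
            rw [Function.update_self]
            omega
          · rw [Function.update_of_ne hlj]
        · rw [Function.update_self]
          omega) (h.advance hj hfree) hle' rfl
      exact ⟨_, .cons (fires_slotMarking hg h hj hfree) hσ⟩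

/-- All processes are sent to a configuration, far enough ahead, with `j` in slot `i` and a gap
directly in front of `j`. -/
theorem live_slotMarking (hg : 0 < g) (h : CyclicOrdered (g + c) A q) {j : Fin c} (hj : j ∈ A)
    (i : ℤ) : (bfNet g c c c).Live (slotMarking g c A q) (regTrans g c c c i (j : ℕ)) := by
  have hc : 0 < c := by have := j.2; omega
  rintro M ⟨σ, hσ⟩
  obtain ⟨q, h, rfl⟩ := hσ.exists_slotMarking hg hc h
  have hp : (1 : ℤ) ≤ ((g + c : ℕ) : ℤ) := by omega
  obtain ⟨N, hN, hle⟩ : ∃ N : ℤ, (N : ZMod (g + c)) = i - (j : ℕ) ∧ ∀ l ∈ A, q l ≤ N := by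
    -- Enough whole turns to pass every `q l`, whatever the sign of `i - j`.
    refine ⟨i - (j : ℕ) + (|i - (j : ℕ)| + ∑ l ∈ A, |q l|) * ((g + c : ℕ) : ℤ), ?_, ?_⟩
    · rw [← intCast_zmod_eq_iff.2 ⟨_, rfl⟩]
      push_cast
      rfl
    · intro l hl
      have h1 : |q l| ≤ ∑ l ∈ A, |q l| :=
        Finset.single_le_sum (f := fun l => |q l|) (fun _ _ => abs_nonneg _) hl
      have h2 := neg_abs_le (i - (j : ℕ))
      have h3 := le_abs_self (q l)
      have h4 := abs_nonneg (i - (j : ℕ))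
      have h5 := abs_nonneg (q l)
      nlinarith
  -- The gap after `j` stretches the row to at most `c + 1` slots, which fit on the ring because `g
  -- > 0`.
  have hT : CyclicOrdered (g + c) A
      fun l => N + (l : ℕ) + if j < l then 1 else 0 := by
    intro a _ b _ hab
    have hb := b.2
    simp only [Fin.lt_def] at *
    split_ifs <;> constructor <;> push_cast <;> omega
  refine ⟨_, reachable_slotMarking hg hc h hT fun l hl => ?_, ?_⟩
  · have := hle l hl
    split_ifs <;> omega
  · have e : (((fun l : Fin c => N + (l : ℕ) + if j < l then 1 else 0) j : ℤ) : ZMod (g + c)) =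
        i := by
      simp only [lt_irrefl, if_false]
      push_cast
      rw [hN]
      simp
    rw [← regTrans_eq_iff.2 ⟨e, rfl⟩]
    refine (fires_slotMarking hg hT hj fun l hl hl' => ?_).1
    obtain ⟨m, hm⟩ := (intCast_zmod_eq_iff (a := N + ((l : ℕ) : ℤ) + if j < l then 1 else 0)
      (b := N + ((j : ℕ) : ℤ) + (if j < j then 1 else 0) + 1)).1 (by simpa using hl')
    have h1 := l.2
    have h2 := j.2
    simp only [Fin.lt_def] at hm
    have : m < 1 := by
      by_contra!
      split_ifs at hm <;> push_cast at * <;> nlinarith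
    have : -1 < m := by
      by_contra!
      split_ifs at hm <;> push_cast at * <;> nlinarith
    obtain rfl : m = 0 := by omega
    split_ifs at hm <;> omega

/-! ### Safety by a place invariant -/

/-- The number of tokens in a slot, where a token on the backward place counts as free space. -/
def slotCount (g c : ℕ) (m : (bfNet g c c c).Place → ℕ) (i : ℤ) : ℕ :=
  m (bPlace g c i) + ∑ j : Fin c, m (fPlace g c (i - 1) (j : ℕ))

open Classical in
theorem slotCount_indicator_pair (a b i : ℤ) (l : Fin c) :
    slotCount g c (Set.indicator {fPlace g c a (l : ℕ), bPlace g c b} fun _ => 1) i =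
      (if (i : ZMod (g + c)) = b then 1 else 0) +
        if ((i - 1 : ℤ) : ZMod (g + c)) = a then 1 else 0 := by
  simp only [slotCount, Set.indicator_apply, Set.mem_insert_iff, Set.mem_singleton_iff,
    fPlace_eq_iff, bPlace_eq_iff, bPlace_ne_fPlace, fPlace_ne_bPlace, fin_zmod_inj, false_or,
    or_false, ite_and]
  congr 1
  split_ifs <;> simp

open Classical in
theorem slotCount_indicator_fPlace (a i : ℤ) (l : Fin c) :
    slotCount g c (Set.indicator {fPlace g c a (l : ℕ)} fun _ => 1) i =
      if ((i - 1 : ℤ) : ZMod (g + c)) = a then 1 else 0 := by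
  simp only [slotCount, Set.indicator_apply, Set.mem_singleton_iff,
    fPlace_eq_iff, bPlace_ne_fPlace, fin_zmod_inj, ite_and, if_false, zero_add]
  split_ifs <;> simp

open Classical in
theorem slotCount_indicator_bPlace (b i : ℤ) :
    slotCount g c (Set.indicator {bPlace g c b} fun _ => 1) i =
      if (i : ZMod (g + c)) = b then 1 else 0 := by
  simp [slotCount, Set.indicator_apply, bPlace_eq_iff]

theorem slotCount_add (m m' : (bfNet g c c c).Place → ℕ) (i : ℤ) :
    slotCount g c (fun x => m x + m' x) i = slotCount g c m i + slotCount g c m' i := by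
  simp only [slotCount, Finset.sum_add_distrib]
  ring

/-- A move trades a process token for a free-space token in the slot left, and conversely in the
slot entered; a stop does the former in a single slot. -/
theorem slotCount_pre_eq_post (hc : 0 < c) (t : (stopNet g c).Trans) (i : ℤ) :
    slotCount g c (((stopNet g c).pre t).indicator fun _ => 1) i =
      slotCount g c (((stopNet g c).post t).indicator fun _ => 1) i := by
  classical
  rcases t with t | j
  · obtain ⟨a, j, rfl⟩ := trans_cases hc t
    have h1 : (stopNet g c).pre (Sum.inl (regTrans g c c c a (j : ℕ))) = _ := pre_regTrans hc a j
    have h2 : (stopNet g c).post (Sum.inl (regTrans g c c c a (j : ℕ))) = _ := post_regTrans hc a j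
    rw [h1, h2, slotCount_indicator_pair, slotCount_indicator_pair, add_comm]
    push_cast
    simp only [sub_eq_iff_eq_add, sub_add_cancel]
  · rw [pre_stop, post_stop, slotCount_indicator_fPlace, slotCount_indicator_bPlace]
    push_cast
    simp only [sub_left_inj]

theorem slotCount_slotMarking (h : CyclicOrdered (g + c) A q) (i : ℤ) :
    slotCount g c ((slotMarking g c A q).indicator fun _ => 1) i = 1 := by
  classical
  simp only [slotCount, Set.indicator_apply, bPlace_mem_slotMarking, fPlace_mem_slotMarking]
  by_cases hi : ∀ j ∈ A, (q j : ZMod (g + c)) ≠ i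
  · rw [if_pos hi, Nat.add_eq_left]
    refine Finset.sum_eq_zero fun j _ => ?_
    rw [if_neg]
    rintro ⟨hj, e⟩
    exact hi j hj (by simpa using e)
  · rw [if_neg hi]
    push Not at hi
    obtain ⟨j, hj, e⟩ := hi
    rw [Finset.sum_eq_single j, if_pos ⟨hj, by simpa using e⟩]
    · intro l _ hl
      rw [if_neg]
      rintro ⟨hl', e'⟩
      exact hl (h.zmod_inj hl' hj (by simpa [e] using e'))
    · simp

/-- Every place belongs to some slot and every slot keeps total count one, also in the unrestricted
token game. -/
theorem safe_slotMarking (hc : 0 < c) (h : CyclicOrdered (g + c) A q) :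
    (stopNet g c).Safe (slotMarking g c A q) := by
  intro m hm
  have inv : ∀ i, slotCount g c m i = 1 := by
    induction hm with
    | refl => exact slotCount_slotMarking h
    | tail _ hstep ih =>
      obtain ⟨t, -, ht⟩ := hstep
      intro i
      have := congrArg (fun m => slotCount g c m i) (funext ht)
      simp only [slotCount_add, ih i, slotCount_pre_eq_post hc t i] at this
      omega
  intro x
  obtain ⟨i, j, rfl⟩ | ⟨i, rfl⟩ := place_cases hc x
  · have h1 := inv (i + 1)
    have h2 : m (fPlace g c (i + 1 - 1) (j : ℕ)) ≤
        ∑ j : Fin c, m (fPlace g c (i + 1 - 1) (j : ℕ)) :=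
      Finset.single_le_sum (f := fun j : Fin c => m (fPlace g c (i + 1 - 1) (j : ℕ)))
        (fun _ _ => Nat.zero_le _) (Finset.mem_univ j)
    rw [add_sub_cancel_right] at h2
    rw [slotCount, add_sub_cancel_right] at h1
    omega
  · have h1 := inv i
    rw [slotCount] at h1
    omega

end

/-! ### Regular markings as slot markings -/

section

variable {g c : ℕ}

theorem cyclicOrdered_add (A : Finset (Fin c)) (k : ℤ) :
    CyclicOrdered (g + c) A fun j => (j : ℕ) + k := by
  intro i _ j _ hij
  have := j.2
  simp only [Fin.lt_def] at hij
  push_cast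
  constructor <;> omega

theorem intCast_zmod_eq_of_lt {p : ℕ} {a b : ℤ} (ha : 0 ≤ a) (hap : a < p) (hb : 0 ≤ b)
    (hbp : b < p) (h : (a : ZMod p) = b) : a = b := by
  rwa [ZMod.intCast_eq_intCast_iff', Int.emod_eq_of_lt ha hap, Int.emod_eq_of_lt hb hbp] at h

/-- The slots that are not among the first `n` ones from the slot `k` on. -/
theorem forall_fin_ne_iff {p n : ℕ} (hp : 0 < p) (y k : ℤ) :
    (∀ l : Fin n, ((l : ℕ) : ZMod p) + k ≠ y) ↔
      ∃ i : ℤ, n ≤ i ∧ i < p ∧ (y : ZMod p) = i + k := by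
  have hp' : (0 : ℤ) < p := by omega
  constructor
  · intro h
    have h1 := Int.emod_nonneg (y - k) hp'.ne'
    have h2 := Int.emod_lt_of_pos (y - k) hp'
    refine ⟨(y - k) % p, ?_, h2, ?_⟩
    · by_contra! hlt
      refine h ⟨((y - k) % p).toNat, by omega⟩ ?_
      rw [← Int.cast_natCast (R := ZMod p)]
      simp only [Int.toNat_of_nonneg h1, ZMod.intCast_mod]
      push_cast
      ring
    · rw [ZMod.intCast_mod]
      push_cast
      ring
  · rintro ⟨i, hi, hip, h⟩ l hl
    have hl' := l.2
    have := intCast_zmod_eq_of_lt (p := p) (a := (l : ℕ)) (b := i) (by omega) (by omega) (by omega)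
      hip (by rw [h] at hl; simpa using hl)
    omega

theorem exists_fin_of_zmod_eq {j : Fin c} {i : ℤ} (h0 : 0 ≤ i) (hi : i < c)
    (h : (((j : ℕ) : ℤ) : ZMod c) = i) : i = (j : ℕ) :=
  (intCast_zmod_eq_of_lt (by omega) (by have := j.2; omega) h0 hi h).symm

theorem bfInit_eq_slotMarking (hc : 0 < c) :
    bfInit g c c c = slotMarking g c Finset.univ fun j => (j : ℕ) := by
  refine eq_slotMarking hc (fun i j => ?_) fun i => ?_
  · simp only [Finset.mem_univ, true_and]
    constructor
    · rintro ⟨_, ⟨l, h0, h1, rfl⟩ | ⟨l, h0, h1, rfl⟩, h⟩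
      · rw [bfClass_mk_fwd, fPlace_eq_iff] at h
        have := exists_fin_of_zmod_eq (by simpa using h0) (by simp only []; omega) h.2.symm
        rw [← h.1, ← this]
        push_cast
        ring
      · rw [bfClass_mk_bwd hc] at h
        exact absurd h bPlace_ne_fPlace
    · intro h
      refine ⟨_, Or.inl ⟨-(j : ℕ), by omega, by have := j.2; omega, rfl⟩, ?_⟩
      rw [bfClass_mk_fwd, fPlace_eq_iff]
      refine ⟨?_, by simp⟩
      push_cast at h ⊢
      rw [h]
      ring
  · have := forall_fin_ne_iff (p := g + c) (n := c) (by omega) i 0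
    simp only [Int.cast_zero, add_zero] at this
    simp only [Finset.mem_univ, true_imp_iff, Int.cast_natCast]
    rw [this]
    constructor
    · rintro ⟨_, ⟨l, h0, h1, rfl⟩ | ⟨l, h0, h1, rfl⟩, h⟩
      · rw [bfClass_mk_fwd] at h
        exact absurd h fPlace_ne_bPlace
      · rw [bfClass_mk_bwd hc, bPlace_eq_iff] at h
        -- The point `(l, -c)` has position `l + c`: the free slots are those from `c` on.
        exact ⟨l + c, by omega, by push_cast; omega, by rw [← h]; simp⟩
    · rintro ⟨l, h0, h1, h⟩
      refine ⟨_, Or.inr ⟨l - c, by omega, by push_cast at h1; omega, rfl⟩, ?_⟩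
      rw [bfClass_mk_bwd hc, bPlace_eq_iff, h]
      simp

theorem bfClass_image_kRegularMarking (hc : 0 < c) (k : ℕ) :
    bfClass g c c c '' kRegularMarking g c c c k =
      slotMarking g c Finset.univ fun j => (j : ℕ) + (k : ℤ) := by
  have hp : (processLength g c c c : ℤ) = ((g + c : ℕ) : ℤ) := by rw [processLength_eq hc]
  unfold kRegularMarking
  simp only [hp]
  refine eq_slotMarking hc (fun i j => ?_) fun i => ?_
  · simp only [Finset.mem_univ, true_and]
    constructor
    · rintro ⟨_, (rfl | ⟨l, h0, h1, rfl⟩) | ⟨l, h0, h1, rfl⟩, h⟩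
      · obtain ⟨h1, h2⟩ := fPlace_eq_iff.1 h
        have := exists_fin_of_zmod_eq le_rfl (by omega) h2.symm
        rw [← h1, ← this, ZMod.intCast_mod]
        push_cast
        -- The separate formula for process `0` differs from the general one by a full turn only.
        have : (g : ZMod (g + c)) + c = 0 := by exact_mod_cast ZMod.natCast_self (g + c)
        linear_combination -this
      · obtain ⟨h1, h2⟩ := fPlace_eq_iff.1 h
        have := exists_fin_of_zmod_eq (by omega) (by omega) h2.symm
        rw [← h1, ← this, ZMod.intCast_mod]
        push_cast
        ring
      · rw [bfClass_regBwd hc] at h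
        exact absurd h bPlace_ne_fPlace
    · intro h
      by_cases hj : (j : ℕ) = 0
      · refine ⟨_, Or.inl (Or.inl rfl), fPlace_eq_iff.2 ⟨?_, by simp [hj]⟩⟩
        rw [ZMod.intCast_mod]
        rw [hj] at h
        push_cast at h ⊢
        have : (g : ZMod (g + c)) + c = 0 := by exact_mod_cast ZMod.natCast_self (g + c)
        linear_combination h + this
      · refine ⟨_, Or.inl (Or.inr ⟨(j : ℕ) - 1, by omega, by have := j.2; omega, rfl⟩),
          fPlace_eq_iff.2 ⟨?_, by simp⟩⟩
        rw [ZMod.intCast_mod]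
        push_cast at h ⊢
        linear_combination h
  · have := forall_fin_ne_iff (p := g + c) (n := c) (by omega) i k
    simp only [Finset.mem_univ, true_imp_iff, Int.cast_natCast, Int.cast_add] at this ⊢
    rw [this]
    constructor
    · rintro ⟨_, (rfl | ⟨l, h0, h1, rfl⟩) | ⟨l, h0, h1, rfl⟩, h⟩
      · exact absurd h fPlace_ne_bPlace
      · exact absurd h fPlace_ne_bPlace
      · rw [bfClass_regBwd hc, bPlace_eq_iff, ZMod.intCast_mod] at h
        exact ⟨l, by push_cast at h0; omega, h1, by rw [← h]; simp⟩
    · rintro ⟨l, h0, h1, h⟩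
      refine ⟨_, Or.inr ⟨l, by push_cast; omega, h1, rfl⟩, ?_⟩
      rw [bfClass_regBwd hc, bPlace_eq_iff, ZMod.intCast_mod, h]
      simp

/-- The enumeration of the processes outside `K` in increasing order. -/
noncomputable def remainingIso {n : ℕ} (K : Finset (Fin c)) (h : Kᶜ.card = n) :
    Fin n ≃o (Kᶜ : Finset (Fin c)) :=
  Finset.orderIsoOfFin Kᶜ h

/-- The remaining processes below the `l`-th one are the images of the `l` smaller indices. -/
theorem remainingIndex_remainingIso {n : ℕ} {K : Finset (Fin c)} (h : Kᶜ.card = n) (l : Fin n) :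
    remainingIndex K (remainingIso K h l) = l := by
  have : (Finset.univ.filter fun j : Fin c => j ∉ K ∧ j < remainingIso K h l) =
      (Finset.Iio l).map ((remainingIso K h).toEquiv.toEmbedding.trans
        (Function.Embedding.subtype _)) := by
    ext j
    simp only [Finset.mem_filter, Finset.mem_univ, true_and, Finset.mem_map, Finset.mem_Iio,
      Function.Embedding.trans_apply, Function.Embedding.subtype_apply]
    constructor
    · rintro ⟨hj, hlt⟩
      obtain ⟨i, hi⟩ := (remainingIso K h).surjective ⟨j, Finset.mem_compl.2 hj⟩
      refine ⟨i, ?_, congrArg Subtype.val hi⟩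
      rw [← (remainingIso K h).lt_iff_lt, hi]
      exact hlt
    · rintro ⟨i, hi, rfl⟩
      exact ⟨Finset.mem_compl.1 (remainingIso K h i).2, (remainingIso K h).lt_iff_lt.2 hi⟩
  rw [remainingIndex, this, Finset.card_map, Fin.card_Iio]

theorem exists_remainingIso_eq {n : ℕ} {K : Finset (Fin c)} (h : Kᶜ.card = n) {j : Fin c}
    (hj : j ∈ Kᶜ) : ∃ l, (remainingIso K h l : Fin c) = j := by
  obtain ⟨i, hi⟩ := (remainingIso K h).surjective ⟨j, hj⟩
  exact ⟨i, congrArg Subtype.val hi⟩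

theorem cyclicOrdered_remainingIndex (K : Finset (Fin c)) (k : ℤ) :
    CyclicOrdered (g + c) Kᶜ fun j => remainingIndex K j + k := by
  intro i hi j hj hij
  obtain ⟨a, rfl⟩ := exists_remainingIso_eq rfl hi
  obtain ⟨b, rfl⟩ := exists_remainingIso_eq rfl hj
  have hab : a < b := (remainingIso K rfl).lt_iff_lt.1 hij
  have hb := b.2
  have hK := Finset.card_le_univ Kᶜ
  rw [Fintype.card_fin] at hK
  simp only [remainingIndex_remainingIso, Fin.lt_def] at hab ⊢
  push_cast
  constructor <;> omega

theorem stoppedRegularMarking_eq_slotMarking (hc : 0 < c) (K : Finset (Fin c)) (k : ℕ) :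
    stoppedRegularMarking g c K k =
      slotMarking g c Kᶜ fun j => remainingIndex K j + (k : ℤ) := by
  have hp : (g : ℤ) + c = ((g + c : ℕ) : ℤ) := by push_cast; rfl
  have hK := Finset.card_le_univ K
  have hcard := Finset.card_compl K
  rw [Fintype.card_fin] at hK hcard
  unfold stoppedRegularMarking
  rw [hp]
  refine eq_slotMarking hc (fun i j => ?_) fun i => ?_
  · constructor
    · rintro (⟨l, hl, h⟩ | ⟨l, -, -, h⟩)
      · obtain ⟨h1, h2⟩ := fPlace_eq_iff.1 h
        obtain rfl := fin_zmod_inj.1 h2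
        refine ⟨Finset.mem_compl.2 hl, ?_⟩
        rw [h1, ZMod.intCast_mod]
        push_cast
        ring
      · rw [bfClass_regBwd hc] at h
        exact absurd h fPlace_ne_bPlace
    · rintro ⟨hj, h⟩
      refine Or.inl ⟨j, Finset.mem_compl.1 hj, fPlace_eq_iff.2 ⟨?_, rfl⟩⟩
      rw [ZMod.intCast_mod]
      push_cast at h ⊢
      linear_combination -h
  · have := forall_fin_ne_iff (p := g + c) (n := Kᶜ.card) (by omega) i k
    have h' : (∀ j ∈ Kᶜ, ((remainingIndex K j + (k : ℤ) : ℤ) : ZMod (g + c)) ≠ i) ↔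
        ∀ l : Fin Kᶜ.card, ((l : ℕ) : ZMod (g + c)) + (k : ℤ) ≠ i := by
      constructor
      · intro h l
        have := h _ (remainingIso K rfl l).2
        simpa [remainingIndex_remainingIso] using this
      · intro h j hj
        obtain ⟨l, rfl⟩ := exists_remainingIso_eq rfl hj
        have := h l
        simpa [remainingIndex_remainingIso] using this
    rw [h', this, hcard]
    constructor
    · rintro (⟨l, -, h⟩ | ⟨l, h0, h1, h⟩)
      · exact absurd h bPlace_ne_fPlace
      · rw [bfClass_regBwd hc, bPlace_eq_iff, ZMod.intCast_mod] at h
        exact ⟨l, by omega, h1, by rw [h]; simp⟩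
    · rintro ⟨l, h0, h1, h⟩
      refine Or.inr ⟨l, by omega, h1, ?_⟩
      rw [bfClass_regBwd hc, bPlace_eq_iff, ZMod.intCast_mod, h]
      simp

/-- Two surjections with the same kernel have equivalent codomains. -/
theorem exists_equiv_of_kernel_eq {X P P' : Type*} (f : X → P) (f' : X → P')
    (hf : f.Surjective) (hf' : f'.Surjective) (h : ∀ x y, f x = f y ↔ f' x = f' y) :
    ∃ e : P ≃ P', ∀ x, e (f x) = f' x := by
  have key : ∀ x, f' (Function.surjInv hf (f x)) = f' x := fun x =>
    (h _ _).1 (Function.surjInv_eq hf (f x))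
  refine ⟨Equiv.ofBijective (fun y => f' (Function.surjInv hf y)) ⟨?_, ?_⟩, key⟩
  · intro a b hab
    have := (h _ _).2 hab
    rwa [Function.surjInv_eq hf, Function.surjInv_eq hf] at this
  · intro y
    obtain ⟨x, rfl⟩ := hf' y
    exact ⟨f x, key x⟩

end

/-! ### The remaining net and its regular markings -/

section

variable {g c : ℕ} {K : Finset (Fin c)}

theorem exists_nat_zmod_eq {p : ℕ} (hp : 0 < p) (i : ℤ) :
    ∃ a : ℕ, a < p ∧ (i : ZMod p) = (a : ℤ) := by
  obtain ⟨l, hl⟩ := exists_fin_zmod_eq hp i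
  exact ⟨l, l.2, hl⟩

theorem fPlace_mem_stoppedPlaces {i : ℤ} {j : Fin c} :
    fPlace g c i (j : ℕ) ∈ stoppedPlaces g c K ↔ j ∈ K := by
  constructor
  · rintro ⟨l, hl, a, -, h⟩
    rwa [fin_zmod_inj.1 (fPlace_eq_iff.1 h).2]
  · intro hj
    obtain ⟨a, ha, h⟩ := exists_nat_zmod_eq (p := g + c) (by have := j.2; omega) i
    exact ⟨j, hj, a, ha, fPlace_eq_iff.2 ⟨h, rfl⟩⟩

theorem bPlace_notMem_stoppedPlaces {i : ℤ} : bPlace g c i ∉ stoppedPlaces g c K := by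
  rintro ⟨l, hl, a, -, h⟩
  exact bPlace_ne_fPlace h

theorem inl_mem_stoppedTrans {i : ℤ} {j : Fin c} :
    (Sum.inl (regTrans g c c c i (j : ℕ)) : (stopNet g c).Trans) ∈ stoppedTrans g c K ↔
      j ∈ K := by
  constructor
  · rintro (⟨l, hl, a, -, h⟩ | ⟨_, h⟩)
    · rwa [fin_zmod_inj.1 (regTrans_eq_iff.1 (Sum.inl.inj h)).2]
    · exact absurd h Sum.inr_ne_inl
  · intro hj
    obtain ⟨a, ha, h⟩ := exists_nat_zmod_eq (p := g + c) (by have := j.2; omega) i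
    exact Or.inl ⟨j, hj, a, ha, congrArg Sum.inl (regTrans_eq_iff.2 ⟨h, rfl⟩)⟩

theorem intCast_zmod_eq_congr {p p' : ℕ} (h : p = p') {a b : ℤ} :
    (a : ZMod p) = b ↔ (a : ZMod p') = b := by
  subst h
  rfl

/-- The remaining net is the total backward folding with as many positions whose processes are
the remaining ones in the order of their indices. -/
theorem exists_iso_remainingNet {g' n : ℕ} (hn : 0 < n) (hK : Kᶜ.card = n)
    (hp : g + c = g' + n) :
    ∃ φ : (remainingNet g c K).Iso (bfNet g' n n n),
      (∀ (i : ℤ) (l : Fin n) (x : (remainingNet g c K).Place),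
        x.1 = fPlace g c i ((remainingIso K hK l : Fin c) : ℕ) →
          φ.onPlaces x = fPlace g' n i (l : ℕ)) ∧
      ∀ (i : ℤ) (x : (remainingNet g c K).Place),
        x.1 = bPlace g c i → φ.onPlaces x = bPlace g' n i := by
  have hc : 0 < c := by have := (remainingIso K hK ⟨0, hn⟩ : Fin c).2; omega
  have hmem : ∀ l, (remainingIso K hK l : Fin c) ∉ K := fun l =>
    Finset.mem_compl.1 (remainingIso K hK l).2
  have hinj : ∀ l l', (remainingIso K hK l : Fin c) = remainingIso K hK l' ↔ l = l' := fun l l' =>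
    Subtype.val_injective.eq_iff.trans (remainingIso K hK).injective.eq_iff
  have hex : ∀ j : Fin c, j ∉ K → ∃ l, (remainingIso K hK l : Fin c) = j := fun j hj =>
    exists_remainingIso_eq hK (Finset.mem_compl.2 hj)
  -- Both nets are parametrized by the same integer coordinates. As the kernels agree, the
  -- bijections arise without transport between the two types `ZMod (g + c)` and `ZMod (g' + n)`.
  let f : (ℤ × Fin n) ⊕ ℤ → (remainingNet g c K).Place
    | .inl (i, l) => ⟨fPlace g c i ((remainingIso K hK l : Fin c) : ℕ),
        fun h => hmem l (fPlace_mem_stoppedPlaces.1 h)⟩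
    | .inr i => ⟨bPlace g c i, bPlace_notMem_stoppedPlaces⟩
  let f' : (ℤ × Fin n) ⊕ ℤ → (bfNet g' n n n).Place
    | .inl (i, l) => fPlace g' n i (l : ℕ)
    | .inr i => bPlace g' n i
  let τ : ℤ × Fin n → (remainingNet g c K).Trans := fun u =>
    ⟨Sum.inl (regTrans g c c c u.1 ((remainingIso K hK u.2 : Fin c) : ℕ)),
      fun h => hmem u.2 (inl_mem_stoppedTrans.1 h)⟩
  let τ' : ℤ × Fin n → (bfNet g' n n n).Trans := fun u => regTrans g' n n n u.1 (u.2 : ℕ)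
  have hf : f.Surjective := by
    rintro ⟨x, hx⟩
    obtain ⟨i, j, rfl⟩ | ⟨i, rfl⟩ := place_cases hc x
    · obtain ⟨l, rfl⟩ := hex j fun hj => hx (fPlace_mem_stoppedPlaces.2 hj)
      exact ⟨.inl (i, l), rfl⟩
    · exact ⟨.inr i, rfl⟩
  have hf' : f'.Surjective := by
    intro x
    obtain ⟨i, j, rfl⟩ | ⟨i, rfl⟩ := place_cases hn x
    · exact ⟨.inl (i, j), rfl⟩
    · exact ⟨.inr i, rfl⟩
  have hτ : τ.Surjective := by
    rintro ⟨t | j, ht⟩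
    · obtain ⟨i, j, rfl⟩ := trans_cases hc t
      obtain ⟨l, rfl⟩ := hex j fun hj => ht (inl_mem_stoppedTrans.2 hj)
      exact ⟨(i, l), rfl⟩
    · exact absurd (Or.inr ⟨j, rfl⟩) ht
  have hτ' : τ'.Surjective := by
    intro t
    obtain ⟨i, j, rfl⟩ := trans_cases hn t
    exact ⟨(i, j), rfl⟩
  have hff : ∀ x y, f x = f y ↔ f' x = f' y := by
    rintro (⟨i, l⟩ | i) (⟨i', l'⟩ | i')
    · refine Subtype.ext_iff.trans ?_
      simp only [f, f', fPlace_eq_iff, fin_zmod_inj, hinj, intCast_zmod_eq_congr hp]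
    · exact iff_of_false (fun h => fPlace_ne_bPlace (Subtype.ext_iff.1 h)) fPlace_ne_bPlace
    · exact iff_of_false (fun h => bPlace_ne_fPlace (Subtype.ext_iff.1 h)) bPlace_ne_fPlace
    · refine Subtype.ext_iff.trans ?_
      simp only [f, f', bPlace_eq_iff, intCast_zmod_eq_congr hp]
  have hττ : ∀ x y, τ x = τ y ↔ τ' x = τ' y := by
    rintro ⟨i, l⟩ ⟨i', l'⟩
    refine Subtype.ext_iff.trans (Sum.inl_injective.eq_iff.trans
      (regTrans_eq_iff.trans (Iff.trans ?_ regTrans_eq_iff.symm)))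
    simp only [fin_zmod_inj, hinj, intCast_zmod_eq_congr hp]
  obtain ⟨φP, hφP⟩ := exists_equiv_of_kernel_eq f f' hf hf' hff
  obtain ⟨φT, hφT⟩ := exists_equiv_of_kernel_eq τ τ' hτ hτ' hττ
  -- Arcs are equations between parametrized places, so equality of the kernels also transfers the
  -- flow relation.
  have hval : ∀ x y, (f x).1 = (f y).1 ↔ f x = f y := fun _ _ => Subtype.ext_iff.symm
  have hinp : ∀ x u, (remainingNet g c K).inp (f x) (τ u) ↔
      (bfNet g' n n n).inp (f' x) (τ' u) := by
    rintro x ⟨i, l⟩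
    exact (bfNet_inp_iff hc).trans ((or_congr
      ((hval x (.inl (i - 1, l))).trans (hff x (.inl (i - 1, l))))
      ((hval x (.inr (i + 1))).trans (hff x (.inr (i + 1))))).trans (bfNet_inp_iff hn).symm)
  have hout : ∀ x u, (remainingNet g c K).out (τ u) (f x) ↔
      (bfNet g' n n n).out (τ' u) (f' x) := by
    rintro x ⟨i, l⟩
    exact (bfNet_out_iff hc).trans ((or_congr ((hval x (.inl (i, l))).trans (hff x (.inl (i, l))))
      ((hval x (.inr i)).trans (hff x (.inr i)))).trans (bfNet_out_iff hn).symm)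
  refine ⟨⟨φP, φT, fun x t => ?_, fun t x => ?_⟩, fun i l x hx => ?_, fun i x hx => ?_⟩
  · obtain ⟨x, rfl⟩ := hf x
    obtain ⟨u, rfl⟩ := hτ t
    rw [hφP, hφT, hinp]
  · obtain ⟨x, rfl⟩ := hf x
    obtain ⟨u, rfl⟩ := hτ t
    rw [hφP, hφT, hout]
  · rw [show x = f (.inl (i, l)) from Subtype.ext hx]
    exact hφP (.inl (i, l))
  · rw [show x = f (.inr i) from Subtype.ext hx]
    exact hφP (.inr i)

/-- Initially each process `j` is in slot `j`, where it can stop, and stops move nobody else; so the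
processes in `K` can stop at once, without any other transition. -/
theorem exists_stopResult (hc : 0 < c) (K : Finset (Fin c)) : ∃ M, StopResult g c K M := by
  suffices h : ∃ M, ∃ σ : List (stopNet g c).Trans,
      (stopNet g c).FiringSeq (bfInit g c c c) σ M ∧
      M = slotMarking g c Kᶜ (fun j => (j : ℕ)) ∧ ∀ j : Fin c, Sum.inr j ∈ σ ↔ j ∈ K by
    obtain ⟨M, σ, h1, -, h2⟩ := h
    exact ⟨M, σ, h1, h2⟩
  induction K using Finset.induction_on with
  | empty => exact ⟨_, [], .nil _, by rw [bfInit_eq_slotMarking hc, Finset.compl_empty], by simp⟩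
  | insert a K ha ih =>
    obtain ⟨_, σ, h1, rfl, h2⟩ := ih
    have hord : CyclicOrdered (g + c) Kᶜ fun j : Fin c => ((j : ℕ) : ℤ) := by
      simpa using cyclicOrdered_add (g := g) Kᶜ 0
    refine ⟨_, σ ++ [Sum.inr a],
      h1.append (.cons (fires_stop_slotMarking hord (Finset.mem_compl.2 ha) rfl) (.nil _)),
      by rw [Finset.compl_insert], fun j => ?_⟩
    simp only [List.mem_append, h2, List.mem_singleton, Sum.inr.injEq, Finset.mem_insert]
    tauto

theorem StopResult.exists_slotMarking (hg : 0 < g) (hc : 0 < c)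
    {M : Set (bfNet g c c c).Place} (h : StopResult g c K M) :
    ∃ q, CyclicOrdered (g + c) Kᶜ q ∧ M = slotMarking g c Kᶜ q := by
  obtain ⟨σ, hσ, hK⟩ := h
  rw [bfInit_eq_slotMarking hc] at hσ
  have hord : CyclicOrdered (g + c) Finset.univ fun j : Fin c => ((j : ℕ) : ℤ) := by
    simpa using cyclicOrdered_add (g := g) Finset.univ 0
  obtain ⟨A, q, h1, h2, h3⟩ := hσ.exists_slotMarking_stop hg hc hord
  obtain rfl : A = Kᶜ := by
    ext j
    rw [h3, hK, Finset.mem_compl]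
    simp
  exact ⟨q, h1, h2⟩

/-- The remaining processes can gather into a regular marking. -/
theorem exists_reachable_stoppedRegularMarking (hg : 0 < g) (hc : 0 < c) {q : Fin c → ℤ}
    (h : CyclicOrdered (g + c) Kᶜ q) :
    ∃ k : ℕ, k < g + c ∧
      (bfNet g c c c).Reachable (slotMarking g c Kᶜ q) (stoppedRegularMarking g c K k) := by
  -- The row of processes is gathered from slot `∑ |q l|` on, which lies behind no `q l`; `k` is its
  -- residue.
  obtain ⟨k, hk, hk'⟩ := exists_nat_zmod_eq (p := g + c) (by omega) (∑ l ∈ Kᶜ, |q l|)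
  refine ⟨k, hk, ?_⟩
  rw [stoppedRegularMarking_eq_slotMarking hc,
    slotMarking_congr (q := fun j => remainingIndex K j + (k : ℤ))
      (q' := fun j => remainingIndex K j + ∑ l ∈ Kᶜ, |q l|) hc]
  · refine reachable_slotMarking hg hc h (cyclicOrdered_remainingIndex K _) fun j hj => ?_
    have h1 : |q j| ≤ ∑ l ∈ Kᶜ, |q l| :=
      Finset.single_le_sum (f := fun l => |q l|) (fun _ _ => abs_nonneg _) hj
    have h2 := le_abs_self (q j)
    omega
  · intro j _
    rw [Int.cast_add, Int.cast_add, hk']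

theorem reachable_kRegularMarking (hg : 0 < g) (hc : 0 < c) (k : ℕ) :
    (bfNet g c c c).Reachable (bfInit g c c c)
      (bfClass g c c c '' kRegularMarking g c c c k) := by
  rw [bfInit_eq_slotMarking hc, bfClass_image_kRegularMarking hc]
  refine reachable_slotMarking hg hc ?_ (cyclicOrdered_add _ _) fun j _ => by omega
  simpa using cyclicOrdered_add (g := g) Finset.univ 0

end

end Net

/-! ### Assembly of the theorem -/

open Net in
theorem mainTheorem1 (g c s : ℕ) (hg : 0 < g) (hs : 0 < s) (hsc : s < c)
    (K : Finset (Fin c)) (hK : K.card = s) :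
    -- the processes in `K` can be stopped, and whenever exactly they have been stopped, the net
    -- is safe and the transitions of the other processes are live
    ((∃ M, StopResult g c K M) ∧
      ∀ M, StopResult g c K M →
        (stopNet g c).Safe M ∧
        ∀ j : Fin c, j ∉ K → ∀ i : ℕ, i < g + c →
          (bfNet g c c c).Live M (regTrans g c c c i (j : ℕ))) ∧
    -- the remaining net is isomorphic to a total backward folding with `s` processes less, also
    -- with respect to regular markings which are reachable in the two systems
    (∃ φ : (remainingNet g c K).Iso (bfNet (g + s) (c - s) (c - s) (c - s)),
      ∀ M, StopResult g c K M →
        ∃ k : ℕ, k < g + c ∧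
          (∃ σ : List (stopNet g c).Trans,
            (stopNet g c).FiringSeq M σ (stoppedRegularMarking g c K k) ∧
            ∀ j : Fin c, Sum.inr j ∉ σ) ∧
          Disjoint (stoppedRegularMarking g c K k) (stoppedPlaces g c K) ∧
          (bfNet (g + s) (c - s) (c - s) (c - s)).Reachable
            (bfInit (g + s) (c - s) (c - s) (c - s))
            (bfClass (g + s) (c - s) (c - s) (c - s) ''
              kRegularMarking (g + s) (c - s) (c - s) (c - s) k) ∧
          φ.onPlaces '' {x | x.1 ∈ stoppedRegularMarking g c K k} =
            bfClass (g + s) (c - s) (c - s) (c - s) ''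
              kRegularMarking (g + s) (c - s) (c - s) (c - s) k) := by
  have hc : 0 < c := by omega
  have hn : 0 < c - s := by omega
  have hp : g + c = g + s + (c - s) := by omega
  have hcard : Kᶜ.card = c - s := by rw [Finset.card_compl, Fintype.card_fin, hK]
  refine ⟨⟨exists_stopResult hc K, fun M hM => ?_⟩, ?_⟩
  · obtain ⟨q, hq, rfl⟩ := StopResult.exists_slotMarking hg hc hM
    exact ⟨safe_slotMarking hc hq, fun j hj i _ =>
      live_slotMarking hg hq (Finset.mem_compl.2 hj) i⟩
  · obtain ⟨φ, hφf, hφb⟩ := exists_iso_remainingNet hn hcard hp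
    refine ⟨φ, fun M hM => ?_⟩
    obtain ⟨q, hq, rfl⟩ := StopResult.exists_slotMarking hg hc hM
    obtain ⟨k, hk, σ, hσ⟩ := exists_reachable_stoppedRegularMarking hg hc hq
    refine ⟨k, hk, ⟨_, hσ.map_inl, by simp⟩, ?_, reachable_kRegularMarking (by omega) hn k, ?_⟩
    · rw [stoppedRegularMarking_eq_slotMarking hc, Set.disjoint_left]
      intro x hx hx'
      obtain ⟨i, j, rfl⟩ | ⟨i, rfl⟩ := place_cases hc x
      · exact Finset.mem_compl.1 (fPlace_mem_slotMarking.1 hx).1 (fPlace_mem_stoppedPlaces.1 hx')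
      · exact bPlace_notMem_stoppedPlaces hx'
    · rw [stoppedRegularMarking_eq_slotMarking hc, bfClass_image_kRegularMarking hn]
      -- Both sides are compared place by place in the coordinates of the smaller net. The rank of
      -- the `l`-th remaining process is `l`, and the two moduli agree.
      refine eq_slotMarking hn (fun i l => ?_) fun i => ?_
      · let x : (remainingNet g c K).Place :=
          ⟨fPlace g c i ((remainingIso K hcard l : Fin c) : ℕ), fun h =>
            Finset.mem_compl.1 (remainingIso K hcard l).2 (fPlace_mem_stoppedPlaces.1 h)⟩
        rw [← hφf i l x rfl, φ.onPlaces.injective.mem_set_image]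
        refine fPlace_mem_slotMarking.trans ?_
        rw [remainingIndex_remainingIso, ← Int.cast_one, ← Int.cast_add,
          intCast_zmod_eq_congr hp, Int.cast_add i]
        simp
      · let x : (remainingNet g c K).Place := ⟨bPlace g c i, bPlace_notMem_stoppedPlaces⟩
        rw [← hφb i x rfl, φ.onPlaces.injective.mem_set_image]
        refine bPlace_mem_slotMarking.trans ?_
        constructor
        · intro h l _
          have := h _ (remainingIso K hcard l).2
          rwa [remainingIndex_remainingIso, Ne, intCast_zmod_eq_congr hp] at this
        · intro h j hj
          obtain ⟨l, rfl⟩ := exists_remainingIso_eq hcard hj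
          rw [remainingIndex_remainingIso, Ne, intCast_zmod_eq_congr hp]
          exact h l (Finset.mem_univ l)
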